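/- Let $d\in\mathbb N$, $s\in(0,1)$, $d>2s$, $m>1$, $\gamma\in[0,2s)\cap[0,d-2s]$, $\gamma_0\in[0,\gamma]$. Let $\rho$ be a measurable weight on $\mathbb R^d$ for which there are constants $0<c<C$ with $c|x|^{-\gamma_0}\le\rho(x)\le C|x|^{-\gamma_0}$ for a.e. $|x|<1$ and $c|x|^{-\gamma}\le\rho(x)\le C|x|^{-\gamma}$ for a.e. $|x|\ge1$, and let $\mu$ be a positive finite Radon measure on $\mathbb R^d$. For $0<r<1$ and $\psi\in C_c^\infty(\mathbb R^d)$ put $$(-\Delta)^r\psi(x)=C_{d,r}\,\mathrm{p.v.}\!\int_{\mathbb R^d}\frac{\psi(x)-\psi(y)}{|x-y|^{d+2r}}\,dy,\qquad C_{d,r}=\frac{4^r\,r\,\Gamma(\tfrac d2+r)}{\pi^{d/2}\,\Gamma(1-r)},$$ and let $\dot H^s(\mathbb R^d)$ be the closure of $C_c^\infty(\mathbb R^d)$ (as a space of functions) with respect to the norm $\|\psi\|_{\dot H^s}^2=\frac{C_{d,s}}2\iint\frac{(\psi(x)-\psi(y))^2}{|x-y|^{d+2s}}\,dx\,dy$.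 For $v\in\dot H^s(\mathbb R^d)$, $(-\Delta)^{s/2}v\in L^2(\mathbb R^d)$ is understood in the sense of distributions. A weak solution of $\rho\,u_t+(-\Delta)^s(u^m)=0$ in $\mathbb R^d\times(0,\infty)$ with $\rho u=\mu$ at $t=0$ is a nonnegative measurable function $u$ on $\mathbb R^d\times(0,\infty)$ such that 1. $u\in L^\infty((0,\infty);L^1_\rho(\mathbb R^d))\cap L^\infty(\mathbb R^d\times(\tau,\infty))$ for all $\tau>0$, where $\|f\|_{1,\rho}=\int_{\mathbb R^d}|f|\,\rho\,dx$; 2. $u^m\in L^2_{\rm loc}((0,\infty);\dot H^s(\mathbb R^d))$; 3. $-\int_0^\infty\!\int_{\mathbb R^d}u\,\varphi_t\,\rho\,dx\,dt+\int_0^\infty\!\int_{\mathbb R^d}(-\Delta)^{s/2}(u^m)\,(-\Delta)^{s/2}\varphi\,dx\,dt=0$ for all $\varphi\in C_c^\infty(\mathbb R^d\times(0,\infty))$; 4. $\operatorname{ess\,lim}_{t\to0}\int_{\mathbb R^d}\phi(x)\,u(x,t)\,\rho(x)\,dx=\int_{\mathbb R^d}\phi\,d\mu$ for all bounded continuous $\phi:\mathbb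 R^d\to\mathbb R$. Then every such weak solution conserves mass: $$\|u(t)\|_{1,\rho}=\int_{\mathbb R^d}u(x,t)\,\rho(x)\,dx=\mu(\mathbb R^d)\qquad\text{for a.e. }t>0.$$ -/

import Mathlib

open MeasureTheory Filter Topology Set
open scoped ContDiff ENNReal

namespace FracPME

noncomputable section

/-- The Euclidean space `ℝ^d`. -/
abbrev E (d : ℕ) : Type := EuclideanSpace ℝ (Fin d)

/-- The normalising constant `C_{d,s}` of the fractional Laplacian,
`C_{d,s} = 4^s s Γ(d/2 + s) / (π^{d/2} Γ(1 - s))` for `0 < s < 1`. -/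
def fracConst (d : ℕ) (s : ℝ) : ℝ :=
  (4 : ℝ) ^ s * s * Real.Gamma ((d : ℝ) / 2 + s) /
    (Real.pi ^ ((d : ℝ) / 2) * Real.Gamma (1 - s))

/-- The space `𝓓(ℝ^d) = C_c^∞(ℝ^d)` of smooth compactly supported functions. -/
def IsTestFun {d : ℕ} (φ : E d → ℝ) : Prop :=
  ContDiff ℝ ∞ φ ∧ HasCompactSupport φ

/-- The fractional Laplacian `(-Δ)^s φ (x)` as a principal value integral
`C_{d,s} lim_{ε → 0+} ∫_{|x - y| > ε} (φ(x) - φ(y)) / |x - y|^{d + 2s} dy`. It is only applied to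
smooth compactly supported functions, for which the limit exists. -/
def fracLap {d : ℕ} (s : ℝ) (φ : E d → ℝ) (x : E d) : ℝ :=
  fracConst d s *
    limUnder (𝓝[>] (0 : ℝ)) fun ε : ℝ =>
      ∫ y in {y : E d | ε < ‖x - y‖}, (φ x - φ y) / ‖x - y‖ ^ ((d : ℝ) + 2 * s)

/-- The squared homogeneous Sobolev norm
`‖v‖²_{Ḣ^s} = (C_{d,s} / 2) ∫∫ (v(x) - v(y))² / |x - y|^{d + 2s} dx dy`, with values in `[0, ∞]`. -/
def hdotNormSq {d : ℕ} (s : ℝ) (v : E d → ℝ) : ℝ≥0∞ :=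
  ENNReal.ofReal (fracConst d s / 2) *
    ∫⁻ x : E d, ∫⁻ y : E d,
      ENNReal.ofReal ((v x - v y) ^ 2 / ‖x - y‖ ^ ((d : ℝ) + 2 * s))

/-- The space `Ḣ^s(ℝ^d)`, the closure of `C_c^∞(ℝ^d)` in the norm above, realised as a space of
functions: `v` is approximated in that norm by test functions which converge to `v` almost
everywhere. The pointwise convergence selects the right function among those that differ by
a constant (a constant has seminorm zero); for `d > 2s` it holds along a subsequence of every
sequence of test functions that is Cauchy in the norm. -/
def MemHdot {d : ℕ} (s : ℝ) (v : E d → ℝ) : Prop :=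
  AEStronglyMeasurable v volume ∧
    ∃ φ : ℕ → E d → ℝ, (∀ n, IsTestFun (φ n)) ∧
      Tendsto (fun n => hdotNormSq s fun x => φ n x - v x) atTop (𝓝 0) ∧
      ∀ᵐ x : E d, Tendsto (fun n => φ n x) atTop (𝓝 (v x))

/-- `g ∈ L²(ℝ^d)` is the fractional Laplacian `(-Δ)^r v` in the sense of distributions:
`∫ v (-Δ)^r ψ dx = ∫ g ψ dx` for all test functions `ψ`. Such a `g` is unique up to null sets. -/
def IsDistribFracLap {d : ℕ} (r : ℝ) (v g : E d → ℝ) : Prop :=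
  MemLp g 2 volume ∧
    ∀ ψ : E d → ℝ, IsTestFun ψ →
      Integrable (fun x => v x * fracLap r ψ x) volume ∧
        ∫ x, v x * fracLap r ψ x = ∫ x, g x * ψ x

/-- The space `L²_loc((0,∞); Ḣ^s(ℝ^d))` for functions of `(x, t)`. -/
def MemL2LocHdot {d : ℕ} (s : ℝ) (v : E d → ℝ → ℝ) : Prop :=
  AEStronglyMeasurable (Function.uncurry v) (volume.restrict (univ ×ˢ Ioi (0 : ℝ))) ∧
    (∀ᵐ t ∂(volume.restrict (Ioi (0 : ℝ))), MemHdot s fun x => v x t) ∧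
    ∀ t₁ t₂ : ℝ, 0 < t₁ → t₁ < t₂ →
      ∫⁻ t in Icc t₁ t₂, hdotNormSq s (fun x => v x t) < (⊤ : ℝ≥0∞)

/-- The space `C_c^∞(ℝ^d × (0,∞))`. -/
def IsSpaceTimeTestFun {d : ℕ} (φ : E d → ℝ → ℝ) : Prop :=
  ContDiff ℝ ∞ (Function.uncurry φ) ∧ HasCompactSupport (Function.uncurry φ) ∧
    tsupport (Function.uncurry φ) ⊆ univ ×ˢ Ioi (0 : ℝ)

/-- The hypotheses on the weight `ρ`: it is Lebesgue measurable and comparable to `|x|^{-γ₀}` in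
the unit ball `B_1` and to `|x|^{-γ}` outside it, almost everywhere. -/
structure IsWeight {d : ℕ} (γ γ₀ : ℝ) (ρ : E d → ℝ) : Prop where
  aemeasurable : AEMeasurable ρ volume
  bounds : ∃ c C : ℝ, 0 < c ∧ c < C ∧
    (∀ᵐ x : E d, ‖x‖ < 1 → c * ‖x‖ ^ (-γ₀) ≤ ρ x ∧ ρ x ≤ C * ‖x‖ ^ (-γ₀)) ∧
    (∀ᵐ x : E d, 1 ≤ ‖x‖ → c * ‖x‖ ^ (-γ) ≤ ρ x ∧ ρ x ≤ C * ‖x‖ ^ (-γ))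

/-- Weak solutions `u` of `ρ u_t + (-Δ)^s (u^m) = 0` in `ℝ^d × (0,∞)` with `ρ u = μ` at `t = 0`.
Only the values of `u` on `ℝ^d × (0,∞)`, up to null sets, matter. -/
structure IsWeakSolution {d : ℕ} (s m : ℝ) (ρ : E d → ℝ) (μ : Measure (E d))
    (u : E d → ℝ → ℝ) : Prop where
  /-- `u` is measurable on `ℝ^d × (0,∞)`. -/
  measurable :
    AEStronglyMeasurable (Function.uncurry u) (volume.restrict (univ ×ˢ Ioi (0 : ℝ)))
  /-- `u` is nonnegative. -/
  nonneg : ∀ᵐ p ∂(volume.restrict ((univ : Set (E d)) ×ˢ Ioi (0 : ℝ))), 0 ≤ u p.1 p.2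
  /-- `u ∈ L^∞((0,∞); L^1_ρ(ℝ^d))`. -/
  bounded_L1 : ∃ M : ℝ, ∀ᵐ t ∂(volume.restrict (Ioi (0 : ℝ))),
    Integrable (fun x => u x t * ρ x) volume ∧ ∫ x, |u x t| * ρ x ≤ M
  /-- `u ∈ L^∞(ℝ^d × (τ,∞))` for all `τ > 0`. -/
  bounded : ∀ τ : ℝ, 0 < τ → ∃ M : ℝ,
    ∀ᵐ p ∂(volume.restrict ((univ : Set (E d)) ×ˢ Ioi τ)), |u p.1 p.2| ≤ M
  /-- `u^m ∈ L²_loc((0,∞); Ḣ^s(ℝ^d))`. -/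
  energy : MemL2LocHdot s fun x t => u x t ^ m
  /-- The weak formulation; `g` is the function `(-Δ)^{s/2}(u^m)`. -/
  weak_eq : ∃ g : E d → ℝ → ℝ,
    AEStronglyMeasurable (Function.uncurry g) (volume.restrict (univ ×ˢ Ioi (0 : ℝ))) ∧
    (∀ᵐ t ∂(volume.restrict (Ioi (0 : ℝ))),
      IsDistribFracLap (s / 2) (fun x => u x t ^ m) (fun x => g x t)) ∧
    ∀ φ : E d → ℝ → ℝ, IsSpaceTimeTestFun φ →
      -(∫ t in Ioi (0 : ℝ), ∫ x, u x t * deriv (fun τ => φ x τ) t * ρ x) +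
        ∫ t in Ioi (0 : ℝ), ∫ x, g x t * fracLap (s / 2) (fun y => φ y t) x = 0
  /-- `ess lim_{t → 0} ρ u(t) = μ`, tested against bounded continuous functions. -/
  initial : ∀ φ : BoundedContinuousFunction (E d) ℝ,
    Tendsto (fun t : ℝ => ∫ x, φ x * (u x t * ρ x)) (ae (volume : Measure ℝ) ⊓ 𝓝[>] 0)
      (𝓝 (∫ x, φ x ∂μ))

end

end FracPME

/-!
Test the equation with `η(t) χ(ε x)`, where `χ` is a smooth cutoff. The function
`(-Δ)^{s/2} (-Δ)^{s/2} [χ(ε ·)]` is bounded by a multiple of `ε^{2s} (1 + |ε x|)^{-d-s}`, hence of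
`ε^{2s-γ} (1 + |x|)^{-γ}` when `γ ≤ d + s`. Since `u^m ≤ N^{m-1} u` where `u ≤ N`, and
`(1 + |x|)^{-γ}` is at most a multiple of `ρ`, the diffusion term is at most a multiple of
`ε^{2s-γ}` times the mass, and vanishes as `ε → 0`. So the mass has zero distributional derivative
on `(0,∞)` and is constant; the initial trace tested with `φ = 1` identifies the constant as
`μ(ℝ^d)`.

Moving `(-Δ)^{s/2}` from `u^m` onto `(-Δ)^{s/2} [χ(ε ·)]` requires approximating the latter, which
is not compactly supported, by test functions. These are obtained by truncating the singular kernel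
and cutting off the tail, with decay and Lipschitz bounds uniform in the approximation.
-/

namespace FracPME

open Module (finrank)

noncomputable section

section Decay

variable {V : Type*} [NormedAddCommGroup V] {p γ : ℝ}

/-- The polynomially decaying profile `(1 + ‖x‖) ^ (-p)`, which measures both the spatial decay of
fractional Laplacians of test functions (`p = d + 2 r`) and that of the weight (`p = γ`). -/
def decay (p : ℝ) (x : V) : ℝ := (1 + ‖x‖) ^ (-p)

lemma decay_pos (p : ℝ) (x : V) : 0 < decay p x :=
  Real.rpow_pos_of_pos (by positivity) _

lemma decay_le_one (hp : 0 ≤ p) (x : V) : decay p x ≤ 1 :=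
  Real.rpow_le_one_of_one_le_of_nonpos (by linarith [norm_nonneg x]) (by linarith)

lemma continuous_decay (p : ℝ) : Continuous (decay p : V → ℝ) :=
  (continuous_const.add continuous_norm).rpow_const fun x =>
    Or.inl (by positivity : (1 : ℝ) + ‖x‖ ≠ 0)

lemma rpow_neg_le_mul_decay {a b : ℝ} (hp : 0 ≤ p) (ha : 0 < a) (hb : 0 < b) {x : V}
    (h : 1 + ‖x‖ ≤ a * b) : b ^ (-p) ≤ a ^ p * decay p x := by
  have hab : (a * b) ^ (-p) ≤ decay p x :=
    Real.rpow_le_rpow_of_nonpos (by positivity) h (by linarith)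
  calc b ^ (-p) = a ^ p * (a * b) ^ (-p) := by
        rw [Real.mul_rpow ha.le hb.le, ← mul_assoc, ← Real.rpow_add ha, add_neg_cancel,
          Real.rpow_zero, one_mul]
    _ ≤ a ^ p * decay p x := by gcongr

-- Either `‖x‖ ≤ 2 ‖x - z‖`, or `‖x‖ ≤ 2 ‖z‖`.
lemma decay_sub_mul_rpow_le (hp : 0 ≤ p) (x : V) {z : V} (hz : 1 ≤ ‖z‖) :
    decay p (x - z) * ‖z‖ ^ (-p) ≤
      decay p x * (2 ^ p * ‖z‖ ^ (-p) + 3 ^ p * decay p (x - z)) := by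
  have hx := decay_pos p x
  have hxz := decay_pos p (x - z)
  have htri : ‖x‖ ≤ ‖x - z‖ + ‖z‖ := norm_le_norm_sub_add x z
  rcases le_total ‖x‖ (2 * ‖x - z‖) with h | h
  · have hle : decay p (x - z) ≤ 2 ^ p * decay p x :=
      rpow_neg_le_mul_decay hp two_pos (by positivity) (by linarith)
    calc decay p (x - z) * ‖z‖ ^ (-p) ≤ 2 ^ p * decay p x * ‖z‖ ^ (-p) := by gcongr
      _ = decay p x * (2 ^ p * ‖z‖ ^ (-p)) := by ring
      _ ≤ _ := by gcongr; exact le_add_of_nonneg_right (by positivity)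
  · have hle : ‖z‖ ^ (-p) ≤ 3 ^ p * decay p x :=
      rpow_neg_le_mul_decay hp three_pos (by linarith) (by linarith)
    calc decay p (x - z) * ‖z‖ ^ (-p) ≤ decay p (x - z) * (3 ^ p * decay p x) := by gcongr
      _ = decay p x * (3 ^ p * decay p (x - z)) := by ring
      _ ≤ _ := by gcongr; exact le_add_of_nonneg_left (by positivity)

lemma decay_smul_le [NormedSpace ℝ V] (hγ : 0 ≤ γ) (hγp : γ ≤ p) {c : ℝ} (hc : c ∈ Ioc (0 : ℝ) 1)
    (x : V) : decay p (c • x) ≤ c ^ (-γ) * decay γ x := by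
  have hx := norm_nonneg x
  have hcx : 0 ≤ c * ‖x‖ := mul_nonneg hc.1.le hx
  rw [decay, decay, norm_smul, Real.norm_of_nonneg hc.1.le,
    ← Real.mul_rpow hc.1.le (by positivity)]
  calc (1 + c * ‖x‖) ^ (-p) ≤ (1 + c * ‖x‖) ^ (-γ) :=
        Real.rpow_le_rpow_of_exponent_le (by linarith) (by linarith)
    _ ≤ (c * (1 + ‖x‖)) ^ (-γ) :=
        Real.rpow_le_rpow_of_nonpos (mul_pos hc.1 (by positivity)) (by linarith [hc.2])
          (by linarith)

end Decay

/-- Functions `f` with `|f| ≤ A (1 + ‖x‖) ^ (-p)` whose local Lipschitz constants are bounded in the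
same way. On this class the singular integrals below converge absolutely and preserve the decay. -/
structure DecayLipschitzWith {V : Type*} [NormedAddCommGroup V] (A p : ℝ) (f : V → ℝ) : Prop where
  bound : ∀ x, |f x| ≤ A * decay p x
  lip : ∀ x z, ‖z‖ ≤ 1 → |f x - f (x - z)| ≤ A * ‖z‖ * decay p x

namespace DecayLipschitzWith

variable {V : Type*} [NormedAddCommGroup V] {A p : ℝ} {f : V → ℝ}

lemma const_nonneg (hf : DecayLipschitzWith A p f) : 0 ≤ A :=
  nonneg_of_mul_nonneg_left ((abs_nonneg _).trans (hf.bound 0)) (decay_pos p 0)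

lemma continuous (hf : DecayLipschitzWith A p f) : Continuous f := by
  refine continuous_iff_continuousAt.2 fun x =>
    continuousAt_of_locally_lipschitz one_pos (A * decay p x) fun y hy => ?_
  have h := hf.lip x (x - y) (by simpa [dist_eq_norm, norm_sub_rev] using hy.le)
  rw [sub_sub_cancel] at h
  rw [dist_comm (f y), dist_comm y, Real.dist_eq, dist_eq_norm]
  linarith

lemma const_mul (hf : DecayLipschitzWith A p f) (c : ℝ) :
    DecayLipschitzWith (|c| * A) p fun x => c * f x where
  bound x := by
    rw [abs_mul, mul_assoc]
    gcongr
    exact hf.bound x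
  lip x z hz := by
    rw [← mul_sub, abs_mul, mul_assoc |c|, mul_assoc |c|]
    gcongr
    exact hf.lip x z hz

lemma mul_left (hf : DecayLipschitzWith A p f) {χ : V → ℝ} {L : NNReal}
    (hL : LipschitzWith L χ) (hχ : ∀ x, |χ x| ≤ 1) :
    DecayLipschitzWith ((1 + L) * A) p fun x => χ x * f x where
  bound x := by
    have hnn : 0 ≤ A * decay p x := mul_nonneg hf.const_nonneg (decay_pos p x).le
    calc |χ x * f x| = |χ x| * |f x| := abs_mul _ _
      _ ≤ 1 * (A * decay p x) := by gcongr; exacts [hχ x, hf.bound x]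
      _ ≤ (1 + L) * (A * decay p x) := by gcongr; simp
      _ = (1 + L) * A * decay p x := by ring
  lip x z hz := by
    have hLz : |χ x - χ (x - z)| ≤ L * ‖z‖ := by simpa using hL.norm_sub_le x (x - z)
    calc |χ x * f x - χ (x - z) * f (x - z)|
        = |χ (x - z) * (f x - f (x - z)) + (χ x - χ (x - z)) * f x| := by ring_nf
      _ ≤ |χ (x - z)| * |f x - f (x - z)| + |χ x - χ (x - z)| * |f x| := by
        rw [← abs_mul, ← abs_mul]; exact abs_add_le _ _
      _ ≤ 1 * (A * ‖z‖ * decay p x) + L * ‖z‖ * (A * decay p x) := by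
        gcongr; exacts [hχ _, hf.lip x z hz, hf.bound x]
      _ = (1 + L) * A * ‖z‖ * decay p x := by ring

lemma of_support_subset_closedBall {B R : ℝ} (hp : 0 ≤ p) (hR : 0 ≤ R) (hB : ∀ x, |f x| ≤ B)
    (hL : ∀ x z, |f x - f (x - z)| ≤ B * ‖z‖) (hsupp : ∀ x, R < ‖x‖ → f x = 0) :
    DecayLipschitzWith ((2 + R) ^ p * B) p f := by
  have hB0 : 0 ≤ B := (abs_nonneg _).trans (hB 0)
  have hdecay : ∀ x : V, 0 ≤ (2 + R) ^ p * decay p x := fun x =>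
    mul_nonneg (by positivity) (decay_pos p x).le
  have hone : ∀ x : V, ‖x‖ ≤ R + 1 → 1 ≤ (2 + R) ^ p * decay p x := fun x hx => by
    simpa using rpow_neg_le_mul_decay hp (by linarith : 0 < 2 + R) one_pos (x := x) (by linarith)
  refine ⟨fun x => ?_, fun x z hz => ?_⟩
  · rw [mul_right_comm]
    rcases le_or_gt ‖x‖ (R + 1) with hx | hx
    · exact (hB x).trans (le_mul_of_one_le_left hB0 (hone x hx))
    · rw [hsupp x (by linarith), abs_zero]
      exact mul_nonneg (hdecay x) hB0
  · rw [mul_assoc _ B, mul_right_comm]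
    have hBz : 0 ≤ B * ‖z‖ := by positivity
    rcases le_or_gt ‖x‖ (R + 1) with hx | hx
    · exact (hL x z).trans (le_mul_of_one_le_left hBz (hone x hx))
    · have hxz : R < ‖x - z‖ := by linarith [norm_sub_norm_le x z]
      rw [hsupp x (by linarith), hsupp _ hxz, sub_zero, abs_zero]
      exact mul_nonneg (hdecay x) hBz

end DecayLipschitzWith

section SmoothCompactSupport

lemma norm_sub_sub_sub_le_of_lipschitzWith_fderiv {V W : Type*} [NormedAddCommGroup V]
    [NormedSpace ℝ V] [NormedAddCommGroup W] [NormedSpace ℝ W] {f : V → W} {L : NNReal}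
    (hf : Differentiable ℝ f) (hL : LipschitzWith L (fderiv ℝ f)) (x y e : V) :
    ‖(f x - f (x - e)) - (f y - f (y - e))‖ ≤ L * ‖e‖ * ‖x - y‖ := by
  have hderiv : ∀ z, HasFDerivAt (fun z => f z - f (z - e))
      (fderiv ℝ f z - fderiv ℝ f (z - e)) z := fun z =>
    (hf z).hasFDerivAt.sub ((hf (z - e)).hasFDerivAt.comp z ((hasFDerivAt_id z).sub_const e))
  refine convex_univ.norm_image_sub_le_of_norm_hasFDerivWithin_le (𝕜 := ℝ)
    (f := fun z => f z - f (z - e))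
    (fun z _ => (hderiv z).hasFDerivWithinAt) (fun z _ => ?_) (mem_univ y) (mem_univ x)
  simpa using hL.norm_sub_le z (z - e)

lemma exists_decayLipschitzWith_of_hasCompactSupport {V : Type*} [NormedAddCommGroup V]
    [NormedSpace ℝ V] {p : ℝ} (hp : 0 ≤ p) {ψ : V → ℝ} (hψ : ContDiff ℝ 2 ψ)
    (hc : HasCompactSupport ψ) :
    ∃ A : ℝ, DecayLipschitzWith A p ψ ∧
      ∀ e : V, ‖e‖ ≤ 1 → DecayLipschitzWith (A * ‖e‖) p fun x => ψ x - ψ (x - e) := by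
  obtain ⟨B, hB⟩ := hc.exists_bound_of_continuous hψ.continuous
  obtain ⟨L, hL⟩ := hψ.lipschitzWith_of_hasCompactSupport hc two_ne_zero
  have hψ' : ContDiff ℝ 1 (fderiv ℝ ψ) := hψ.fderiv_right (by norm_num)
  obtain ⟨L', hL'⟩ := hψ'.lipschitzWith_of_hasCompactSupport (hc.fderiv ℝ) one_ne_zero
  obtain ⟨R, hR0, hR⟩ := hc.isCompact.isBounded.exists_pos_norm_le
  have hzero : ∀ x, R < ‖x‖ → ψ x = 0 := fun x hx =>
    image_eq_zero_of_notMem_tsupport fun h => (hR x h).not_gt hx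
  obtain ⟨M, hBM, hLM, hLM'⟩ : ∃ M : ℝ, B ≤ M ∧ L ≤ M ∧ L' ≤ M :=
    ⟨max B (max L L'), by simp⟩
  have hψL : ∀ x z, |ψ x - ψ (x - z)| ≤ M * ‖z‖ := fun x z => by
    have h := hL.norm_sub_le x (x - z)
    rw [sub_sub_cancel] at h
    exact h.trans (by gcongr)
  refine ⟨(2 + (R + 1)) ^ p * M, ?_, fun e he => ?_⟩
  · exact .of_support_subset_closedBall hp (by linarith) (fun x => (hB x).trans hBM) hψL
      fun x hx => hzero x (by linarith)
  · rw [mul_assoc]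
    refine .of_support_subset_closedBall hp (by linarith) (fun x => hψL x e) (fun x z => ?_)
      fun x hx => ?_
    · have h := norm_sub_sub_sub_le_of_lipschitzWith_fderiv (hψ.differentiable two_ne_zero) hL'
        x (x - z) e
      rw [sub_sub_cancel] at h
      exact h.trans (by gcongr)
    · rw [hzero x (by linarith), hzero (x - e) (by linarith [norm_sub_norm_le x e]), sub_zero]

end SmoothCompactSupport

section Kernels

variable {V : Type*} [NormedAddCommGroup V] {p : ℝ}

/-- The kernel `‖z‖ ^ (-p)` tempered near the origin by the gain of a Lipschitz bound. -/
def regKernel (p : ℝ) (z : V) : ℝ := min 1 ‖z‖ * ‖z‖ ^ (-p)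

lemma regKernel_nonneg (p : ℝ) (z : V) : 0 ≤ regKernel p z := by
  unfold regKernel; positivity

/-- The kernel `‖z‖ ^ (-p)` truncated at distance `ε` from its singularity. -/
def truncKernel (p ε : ℝ) : V → ℝ := indicator {z | ε < ‖z‖} fun z => ‖z‖ ^ (-p)

lemma truncKernel_nonneg (p ε : ℝ) (z : V) : 0 ≤ truncKernel p ε z :=
  indicator_nonneg (fun _ _ => by positivity) z

lemma abs_truncKernel_le (p ε : ℝ) (z : V) : |truncKernel p ε z| ≤ ‖z‖ ^ (-p) := by
  rw [abs_of_nonneg (truncKernel_nonneg p ε z)]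
  exact indicator_le_self' (fun _ _ => by positivity) z

lemma measurable_truncKernel [MeasurableSpace V] [OpensMeasurableSpace V] (p ε : ℝ) :
    Measurable (truncKernel p ε : V → ℝ) :=
  (measurable_norm.pow_const _).indicator (measurableSet_lt measurable_const measurable_norm)

lemma truncKernel_le_mul_regKernel {ε : ℝ} (hε : 0 < ε) (z : V) :
    truncKernel p ε z ≤ (min 1 ε)⁻¹ * regKernel p z := by
  have hm : 0 < min 1 ε := lt_min one_pos hε
  refine indicator_apply_le' (fun hz => ?_) fun _ =>
    mul_nonneg (by positivity) (regKernel_nonneg p z)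
  have hz : ε < ‖z‖ := hz
  rw [le_inv_mul_iff₀ hm, regKernel]
  gcongr

lemma DecayLipschitzWith.abs_sub_mul_rpow_le {A : ℝ} {f : V → ℝ} (hp : 0 ≤ p)
    (hf : DecayLipschitzWith A p f) (x z : V) :
    |f x - f (x - z)| * ‖z‖ ^ (-p) ≤
      A * decay p x * ((1 + 2 ^ p) * regKernel p z + 3 ^ p * decay p (x - z)) := by
  have hA := hf.const_nonneg
  have hx := decay_pos p x
  have hxz := decay_pos p (x - z)
  rcases le_total ‖z‖ 1 with hz | hz
  · have hreg : regKernel p z = ‖z‖ * ‖z‖ ^ (-p) := by rw [regKernel, min_eq_right hz]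
    have hnn := regKernel_nonneg p z
    calc |f x - f (x - z)| * ‖z‖ ^ (-p) ≤ A * ‖z‖ * decay p x * ‖z‖ ^ (-p) := by
          gcongr; exact hf.lip x z hz
      _ = A * decay p x * (1 * regKernel p z + 0) := by rw [hreg]; ring
      _ ≤ _ := by
          gcongr
          · exact le_add_of_nonneg_right (by positivity)
          · positivity
  · have hreg : regKernel p z = ‖z‖ ^ (-p) := by rw [regKernel, min_eq_left hz, one_mul]
    calc |f x - f (x - z)| * ‖z‖ ^ (-p)
        ≤ (A * decay p x + A * decay p (x - z)) * ‖z‖ ^ (-p) := by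
          gcongr; exact (abs_sub _ _).trans (add_le_add (hf.bound x) (hf.bound _))
      _ = A * (decay p x * ‖z‖ ^ (-p) + decay p (x - z) * ‖z‖ ^ (-p)) := by ring
      _ ≤ A * (decay p x * ‖z‖ ^ (-p) +
            decay p x * (2 ^ p * ‖z‖ ^ (-p) + 3 ^ p * decay p (x - z))) := by
          exact mul_le_mul_of_nonneg_left (add_le_add_right (decay_sub_mul_rpow_le hp x hz) _) hA
      _ = _ := by rw [hreg]; ring

end Kernels

section NonlocalOp

variable {V : Type*} [NormedAddCommGroup V] [MeasureSpace V]

/-- The nonlocal operator `f ↦ ∫ (f(x) - f(y)) K(x - y) dy` with kernel `K`, written in terms of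
`z = x - y`. With `K z = ‖z‖ ^ (-p)`, `p = d + 2 r`, it is a multiple of the fractional Laplacian of
order `r`. -/
def nonlocalOp (K f : V → ℝ) (x : V) : ℝ :=
  ∫ z, (f x - f (x - z)) * K z

lemma nonlocalOp_const_mul (K : V → ℝ) (c : ℝ) (f : V → ℝ) (x : V) :
    nonlocalOp K (fun y => c * f y) x = c * nonlocalOp K f x := by
  simp only [nonlocalOp, ← integral_const_mul, ← mul_sub, mul_assoc]

variable [BorelSpace V] {K ψ : V → ℝ}

lemma integrable_sub_mul [SecondCountableTopology V] (hK : Integrable K) (hψ : Continuous ψ)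
    (hc : HasCompactSupport ψ) (x : V) : Integrable fun z => (ψ x - ψ (x - z)) * K z := by
  obtain ⟨B, hB⟩ := hc.exists_bound_of_continuous hψ
  exact hK.bdd_mul (c := B + B) (by fun_prop)
    (ae_of_all _ fun z => (norm_sub_le _ _).trans (add_le_add (hB _) (hB _)))

lemma nonlocalOp_sub_nonlocalOp [SecondCountableTopology V] (hK : Integrable K)
    (hψ : Continuous ψ) (hc : HasCompactSupport ψ) (x e : V) :
    nonlocalOp K ψ x - nonlocalOp K ψ (x - e) = nonlocalOp K (fun y => ψ y - ψ (y - e)) x := by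
  rw [nonlocalOp, nonlocalOp, nonlocalOp, ← integral_sub (integrable_sub_mul hK hψ hc x)
    (integrable_sub_mul hK hψ hc (x - e))]
  refine integral_congr_ae (ae_of_all _ fun z => ?_)
  simp only [sub_right_comm x e z]
  ring

lemma contDiff_nonlocalOp [NormedSpace ℝ V] (hK : Integrable K) (hψ : ContDiff ℝ ∞ ψ)
    (hc : HasCompactSupport ψ) : ContDiff ℝ ∞ (nonlocalOp K ψ) := by
  obtain ⟨B, hB⟩ := hc.exists_bound_of_continuous hψ.continuous
  have hconv : ContDiff ℝ ∞ (convolution K ψ (ContinuousLinearMap.mul ℝ ℝ) volume) :=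
    hc.contDiff_convolution_right _ hK.locallyIntegrable hψ
  have hsplit : nonlocalOp K ψ =
      fun x => ψ x * (∫ z, K z) - convolution K ψ (ContinuousLinearMap.mul ℝ ℝ) volume x := by
    ext x
    have hint : Integrable fun z => ψ (x - z) * K z :=
      hK.bdd_mul (hψ.continuous.comp (by fun_prop)).aestronglyMeasurable (ae_of_all _ fun z => hB _)
    simp only [nonlocalOp, convolution, ContinuousLinearMap.mul_apply', sub_mul]
    rw [integral_sub (hK.const_mul _) hint, integral_const_mul]
    simp only [mul_comm]
  rw [hsplit]
  exact (hψ.mul contDiff_const).sub hconv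

end NonlocalOp

section SingularIntegrals

variable {V : Type*} [NormedAddCommGroup V] [NormedSpace ℝ V] [FiniteDimensional ℝ V]
  [MeasureSpace V] [BorelSpace V] [(volume : Measure V).IsAddHaarMeasure] {p : ℝ}

lemma integrable_decay (hp : finrank ℝ V < p) : Integrable (decay p : V → ℝ) :=
  integrable_one_add_norm hp

lemma integrable_decay_sq (hp : finrank ℝ V < 2 * p) : Integrable fun x : V => decay p x ^ 2 := by
  refine (integrable_decay hp).congr (ae_of_all _ fun x => ?_)
  simp only [decay]
  rw [← Real.rpow_natCast, ← Real.rpow_mul (by positivity)]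
  congr 1
  push_cast
  ring

lemma memLp_two_decay_comp_smul (hp : finrank ℝ V < 2 * p) {c : ℝ} (hc : c ≠ 0) :
    MemLp (fun x : V => decay p (c • x)) 2 := by
  have hcont : Continuous fun x : V => decay p (c • x) :=
    (continuous_decay p).comp (continuous_const_smul c)
  rw [memLp_two_iff_integrable_sq hcont.aestronglyMeasurable]
  exact (integrable_decay_sq hp).comp_smul hc

lemma integrableOn_Ioi_min_one_mul_rpow {a : ℝ} (ha : a ∈ Ioo (-2 : ℝ) (-1)) :
    IntegrableOn (fun y : ℝ => min 1 y * y ^ a) (Ioi 0) := by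
  rw [← Ioc_union_Ioi_eq_Ioi (zero_le_one' ℝ)]
  refine .union ?_ ?_
  · have h : IntegrableOn (fun y : ℝ => y ^ (1 + a)) (Ioc 0 1) := by
      rw [← intervalIntegrable_iff_integrableOn_Ioc_of_le zero_le_one]
      exact intervalIntegral.intervalIntegrable_rpow' (by linarith [ha.1])
    refine h.congr_fun (fun y hy => ?_) measurableSet_Ioc
    simp only [min_eq_right hy.2, Real.rpow_one_add' hy.1.le (by linarith [ha.2] : 1 + a ≠ 0)]
  · refine (integrableOn_Ioi_rpow_of_lt ha.2 one_pos).congr_fun (fun y hy => ?_) measurableSet_Ioi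
    rw [min_eq_left (le_of_lt hy), one_mul]

lemma integrable_regKernel (hp : p ∈ Ioo (finrank ℝ V : ℝ) (finrank ℝ V + 1)) :
    Integrable (regKernel p : V → ℝ) := by
  rcases subsingleton_or_nontrivial V with _ | _
  · exact .of_finite
  refine (integrable_fun_norm_addHaar volume (f := fun y : ℝ => min 1 y * y ^ (-p))).2 ?_
  have hdim : 1 ≤ finrank ℝ V := Module.finrank_pos
  refine (integrableOn_Ioi_min_one_mul_rpow (a := finrank ℝ V - 1 - p)
    ⟨by linarith [hp.2], by linarith [hp.1]⟩).congr_fun (fun y hy => ?_) measurableSet_Ioi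
  have hy : 0 < y := hy
  rw [smul_eq_mul, mul_left_comm, ← Real.rpow_natCast, Nat.cast_sub hdim, Nat.cast_one,
    ← Real.rpow_add hy, ← sub_eq_add_neg]

lemma integrable_truncKernel (hp : p ∈ Ioo (finrank ℝ V : ℝ) (finrank ℝ V + 1)) {ε : ℝ}
    (hε : 0 < ε) : Integrable (truncKernel p ε : V → ℝ) := by
  refine ((integrable_regKernel hp).const_mul (min 1 ε)⁻¹).mono'
    (measurable_truncKernel p ε).aestronglyMeasurable (ae_of_all _ fun z => ?_)
  rw [Real.norm_of_nonneg (truncKernel_nonneg p ε z)]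
  exact truncKernel_le_mul_regKernel hε z

lemma integrable_singular_majorant (hp : p ∈ Ioo (finrank ℝ V : ℝ) (finrank ℝ V + 1))
    (a b : ℝ) (x : V) : Integrable fun z => a * regKernel p z + b * decay p (x - z) :=
  ((integrable_regKernel hp).const_mul a).add
    (((integrable_decay hp.1).comp_sub_left x).const_mul b)

/-- A bound for the norm of `f ↦ ∫ z, (f x - f (x - z)) * ‖z‖ ^ (-p)` on functions which decay
like `decay p`. -/
def decayConst (V : Type*) [NormedAddCommGroup V] [MeasureSpace V] (p : ℝ) : ℝ :=
  (1 + 2 ^ p) * (∫ z : V, regKernel p z) + 3 ^ p * ∫ z : V, decay p z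

lemma decayConst_nonneg (V : Type*) [NormedAddCommGroup V] [MeasureSpace V] (p : ℝ) :
    0 ≤ decayConst V p := by
  have hreg : 0 ≤ ∫ z : V, regKernel p z := integral_nonneg fun z => regKernel_nonneg p z
  have hdecay : 0 ≤ ∫ z : V, decay p z := integral_nonneg fun z => (decay_pos p z).le
  unfold decayConst
  positivity

namespace DecayLipschitzWith

variable {A : ℝ} {f : V → ℝ}

lemma abs_nonlocalOp_le (hp : p ∈ Ioo (finrank ℝ V : ℝ) (finrank ℝ V + 1)) {K : V → ℝ}
    (hK : ∀ z, |K z| ≤ ‖z‖ ^ (-p)) (hf : DecayLipschitzWith A p f) (x : V) :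
    |nonlocalOp K f x| ≤ decayConst V p * A * decay p x := by
  have hp0 : 0 ≤ p := (Nat.cast_nonneg _).trans hp.1.le
  have hint := integrable_singular_majorant hp (1 + 2 ^ p) (3 ^ p) x
  calc |nonlocalOp K f x|
      ≤ ∫ z, A * decay p x * ((1 + 2 ^ p) * regKernel p z + 3 ^ p * decay p (x - z)) := by
        rw [nonlocalOp, ← Real.norm_eq_abs]
        refine norm_integral_le_of_norm_le (hint.const_mul _) (ae_of_all _ fun z => ?_)
        rw [norm_mul, Real.norm_eq_abs, Real.norm_eq_abs]
        exact (mul_le_mul_of_nonneg_left (hK z) (abs_nonneg _)).trans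
          (hf.abs_sub_mul_rpow_le hp0 x z)
    _ = decayConst V p * A * decay p x := by
        rw [integral_const_mul, integral_add ((integrable_regKernel hp).const_mul _)
          (((integrable_decay hp.1).comp_sub_left x).const_mul _), integral_const_mul,
          integral_const_mul, integral_sub_left_eq_self (decay p : V → ℝ) volume x,
          decayConst]
        ring

lemma tendsto_nonlocalOp_truncKernel (hp : p ∈ Ioo (finrank ℝ V : ℝ) (finrank ℝ V + 1))
    (hf : DecayLipschitzWith A p f) (x : V) :
    Tendsto (fun ε => nonlocalOp (truncKernel p ε) f x) (𝓝[>] 0)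
      (𝓝 (nonlocalOp (fun z => ‖z‖ ^ (-p)) f x)) := by
  have hp0 : 0 ≤ p := (Nat.cast_nonneg _).trans hp.1.le
  have hcont : Continuous fun z => f x - f (x - z) :=
    continuous_const.sub (hf.continuous.comp (continuous_const.sub continuous_id))
  refine tendsto_integral_filter_of_dominated_convergence _ (Eventually.of_forall fun ε =>
      (hcont.measurable.mul (measurable_truncKernel p ε)).aestronglyMeasurable)
    (Eventually.of_forall fun ε => ae_of_all _ fun z => ?_)
    ((integrable_singular_majorant hp (1 + 2 ^ p) (3 ^ p) x).const_mul (A * decay p x))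
    (ae_of_all _ fun z => ?_)
  · rw [norm_mul, Real.norm_eq_abs, Real.norm_eq_abs]
    exact (mul_le_mul_of_nonneg_left (abs_truncKernel_le p ε z) (abs_nonneg _)).trans
      (hf.abs_sub_mul_rpow_le hp0 x z)
  · rcases eq_or_ne z 0 with rfl | hz
    · simp
    · refine tendsto_const_nhds.congr' ?_
      filter_upwards [Ioo_mem_nhdsGT (norm_pos_iff.2 hz)] with ε hε
      rw [truncKernel, indicator_of_mem (show z ∈ {z : V | ε < ‖z‖} from hε.2)]

end DecayLipschitzWith

lemma setIntegral_eq_nonlocalOp_truncKernel (p ε : ℝ) (f : V → ℝ) (x : V) :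
    ∫ y in {y | ε < ‖x - y‖}, (f x - f y) / ‖x - y‖ ^ p = nonlocalOp (truncKernel p ε) f x := by
  rw [nonlocalOp,
    ← integral_sub_left_eq_self (fun z => (f x - f (x - z)) * truncKernel p ε z) volume x,
    ← integral_indicator (measurableSet_lt measurable_const (by fun_prop))]
  refine integral_congr_ae (ae_of_all _ fun y => ?_)
  simp only [truncKernel, indicator, mem_ofPred_eq, sub_sub_cancel, mul_ite, mul_zero,
    Real.rpow_neg (norm_nonneg _), div_eq_mul_inv]

lemma nonlocalOp_comp_smul {c : ℝ} (hc : 0 < c) (p : ℝ) (f : V → ℝ) (x : V) :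
    nonlocalOp (fun z => ‖z‖ ^ (-p)) (fun y => f (c • y)) x =
      c ^ (p - finrank ℝ V) * nonlocalOp (fun z => ‖z‖ ^ (-p)) f (c • x) := by
  have hscale : ∀ z : V, (f (c • x) - f (c • (x - z))) * ‖z‖ ^ (-p) =
      c ^ p * ((f (c • x) - f (c • x - c • z)) * ‖c • z‖ ^ (-p)) := fun z => by
    rw [smul_sub, norm_smul, Real.norm_of_nonneg hc.le, Real.mul_rpow hc.le (norm_nonneg _),
      Real.rpow_neg hc.le]
    field_simp
  simp only [nonlocalOp, hscale]
  rw [integral_const_mul, Measure.integral_comp_smul_of_nonneg volume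
    (fun z => (f (c • x) - f (c • x - z)) * ‖z‖ ^ (-p)) c (hR := hc.le), smul_eq_mul,
    Real.rpow_sub hc, Real.rpow_natCast, div_eq_mul_inv, mul_assoc]

lemma decayLipschitzWith_nonlocalOp (hp : p ∈ Ioo (finrank ℝ V : ℝ) (finrank ℝ V + 1)) {A : ℝ}
    {K ψ : V → ℝ} (hK : Integrable K) (hKp : ∀ z, |K z| ≤ ‖z‖ ^ (-p)) (hψ : Continuous ψ)
    (hc : HasCompactSupport ψ) (hA : DecayLipschitzWith A p ψ)
    (hA' : ∀ e : V, ‖e‖ ≤ 1 → DecayLipschitzWith (A * ‖e‖) p fun x => ψ x - ψ (x - e)) :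
    DecayLipschitzWith (decayConst V p * A) p (nonlocalOp K ψ) where
  bound x := hA.abs_nonlocalOp_le hp hKp x
  lip x e he := by
    rw [nonlocalOp_sub_nonlocalOp hK hψ hc, mul_assoc (decayConst V p)]
    exact (hA' e he).abs_nonlocalOp_le hp hKp x

end SingularIntegrals

section FractionalLaplacian

variable {d : ℕ} {r A : ℝ} {f ψ : E d → ℝ}

lemma add_two_mul_mem_Ioo_finrank (d : ℕ) (hr : r ∈ Ioo (0 : ℝ) (1 / 2)) :
    (d : ℝ) + 2 * r ∈ Ioo (finrank ℝ (E d) : ℝ) (finrank ℝ (E d) + 1) := by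
  rw [finrank_euclideanSpace_fin]
  constructor <;> linarith [hr.1, hr.2]

lemma DecayLipschitzWith.fracLap_eq (hr : r ∈ Ioo (0 : ℝ) (1 / 2))
    (hf : DecayLipschitzWith A (d + 2 * r) f) (x : E d) :
    fracLap r f x = fracConst d r * nonlocalOp (fun z => ‖z‖ ^ (-(d + 2 * r))) f x := by
  simp only [fracLap, setIntegral_eq_nonlocalOp_truncKernel]
  rw [(hf.tendsto_nonlocalOp_truncKernel (add_two_mul_mem_Ioo_finrank d hr) x).limUnder_eq]

lemma DecayLipschitzWith.abs_fracLap_le (hr : r ∈ Ioo (0 : ℝ) (1 / 2))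
    (hf : DecayLipschitzWith A (d + 2 * r) f) (x : E d) :
    |fracLap r f x| ≤
      |fracConst d r| * (decayConst (E d) (d + 2 * r) * A * decay (d + 2 * r) x) := by
  rw [hf.fracLap_eq hr, abs_mul]
  gcongr
  exact hf.abs_nonlocalOp_le (add_two_mul_mem_Ioo_finrank d hr)
    (fun z => (abs_of_nonneg (by positivity)).le) x

namespace IsTestFun

lemma const_mul (hψ : IsTestFun ψ) (c : ℝ) : IsTestFun fun x => c * ψ x :=
  ⟨contDiff_const.mul hψ.1, hψ.2.mul_left⟩

lemma comp_smul (hψ : IsTestFun ψ) {c : ℝ} (hc : c ≠ 0) : IsTestFun fun x => ψ (c • x) :=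
  ⟨hψ.1.comp (contDiff_const_smul c), hψ.2.comp_smul hc⟩

lemma exists_decayLipschitzWith (hψ : IsTestFun ψ) {p : ℝ} (hp : 0 ≤ p) :
    ∃ A : ℝ, DecayLipschitzWith A p ψ ∧
      ∀ e : E d, ‖e‖ ≤ 1 → DecayLipschitzWith (A * ‖e‖) p fun x => ψ x - ψ (x - e) :=
  exists_decayLipschitzWith_of_hasCompactSupport hp (contDiff_infty.1 hψ.1 2) hψ.2

lemma fracLap_eq (hr : r ∈ Ioo (0 : ℝ) (1 / 2)) (hψ : IsTestFun ψ) (x : E d) :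
    fracLap r ψ x = fracConst d r * nonlocalOp (fun z => ‖z‖ ^ (-(d + 2 * r))) ψ x := by
  have hr0 := hr.1
  obtain ⟨A, hA, -⟩ := hψ.exists_decayLipschitzWith (p := d + 2 * r) (by positivity)
  exact hA.fracLap_eq hr x

lemma fracLap_const_mul (hr : r ∈ Ioo (0 : ℝ) (1 / 2)) (hψ : IsTestFun ψ) (c : ℝ) (x : E d) :
    fracLap r (fun y => c * ψ y) x = c * fracLap r ψ x := by
  rw [hψ.fracLap_eq hr, (hψ.const_mul c).fracLap_eq hr, nonlocalOp_const_mul, mul_left_comm]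

lemma fracLap_comp_smul (hr : r ∈ Ioo (0 : ℝ) (1 / 2)) (hψ : IsTestFun ψ) {c : ℝ} (hc : 0 < c)
    (x : E d) : fracLap r (fun y => ψ (c • y)) x = c ^ (2 * r) * fracLap r ψ (c • x) := by
  rw [hψ.fracLap_eq hr, (hψ.comp_smul hc.ne').fracLap_eq hr, nonlocalOp_comp_smul hc,
    mul_left_comm, finrank_euclideanSpace_fin, add_sub_cancel_left]

lemma exists_decayLipschitzWith_nonlocalOp (hr : r ∈ Ioo (0 : ℝ) (1 / 2)) (hψ : IsTestFun ψ) :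
    ∃ A : ℝ, ∀ ε : ℝ, 0 < ε →
      DecayLipschitzWith A (d + 2 * r) (nonlocalOp (truncKernel (d + 2 * r) ε) ψ) := by
  have hp := add_two_mul_mem_Ioo_finrank d hr
  obtain ⟨A, hA, hA'⟩ := hψ.exists_decayLipschitzWith ((Nat.cast_nonneg _).trans hp.1.le)
  exact ⟨_, fun ε hε => decayLipschitzWith_nonlocalOp hp (integrable_truncKernel hp hε)
    (abs_truncKernel_le _ ε) hψ.1.continuous hψ.2 hA hA'⟩

end IsTestFun

/-- A smooth cutoff function with values in `[0, 1]`, equal to `1` on the unit ball and to `0`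
outside the ball of radius `2`. -/
def unitBump (d : ℕ) : ContDiffBump (0 : E d) := ⟨1, 2, one_pos, one_lt_two⟩

lemma isTestFun_unitBump (d : ℕ) : IsTestFun (unitBump d) :=
  ⟨(unitBump d).contDiff, (unitBump d).hasCompactSupport⟩

lemma abs_unitBump_le_one (x : E d) : |unitBump d x| ≤ 1 := by
  rw [abs_of_nonneg (unitBump d).nonneg]
  exact (unitBump d).le_one

lemma tendsto_unitBump_smul (x : E d) :
    Tendsto (fun ε : ℝ => unitBump d (ε • x)) (𝓝[>] 0) (𝓝 1) := by
  have hcont : Continuous fun ε : ℝ => unitBump d (ε • x) :=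
    (unitBump d).continuous.comp (continuous_id.smul continuous_const)
  have hone : unitBump d ((0 : ℝ) • x) = 1 :=
    (unitBump d).one_of_mem_closedBall (by simp [unitBump])
  simpa only [hone] using (hcont.tendsto 0).mono_left nhdsWithin_le_nhds

/-- Test functions approximating `(-Δ)^r ψ`, which itself is not compactly supported: the singular
kernel is truncated at distance `ε`, and the tail is cut off at distance `1 / ε`. -/
def fracLapApprox (r : ℝ) (ψ : E d → ℝ) (ε : ℝ) (x : E d) : ℝ :=
  fracConst d r * (unitBump d (ε • x) * nonlocalOp (truncKernel (d + 2 * r) ε) ψ x)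

lemma isTestFun_fracLapApprox (hr : r ∈ Ioo (0 : ℝ) (1 / 2)) (hψ : IsTestFun ψ) {ε : ℝ}
    (hε : 0 < ε) : IsTestFun (fracLapApprox r ψ ε) := by
  have hK := integrable_truncKernel (add_two_mul_mem_Ioo_finrank d hr) hε
  have hbump := (isTestFun_unitBump d).comp_smul hε.ne'
  exact .const_mul ⟨hbump.1.mul (contDiff_nonlocalOp hK hψ.1 hψ.2), hbump.2.mul_right⟩ _

namespace IsTestFun

lemma exists_decayLipschitzWith_fracLapApprox (hr : r ∈ Ioo (0 : ℝ) (1 / 2)) (hψ : IsTestFun ψ) :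
    ∃ A : ℝ, ∀ ε ∈ Ioc (0 : ℝ) 1,
      DecayLipschitzWith A (d + 2 * r) (fracLapApprox r ψ ε) := by
  obtain ⟨A, hA⟩ := hψ.exists_decayLipschitzWith_nonlocalOp hr
  have hbump := isTestFun_unitBump d
  obtain ⟨L, hL⟩ := hbump.1.lipschitzWith_of_hasCompactSupport hbump.2 (by simp)
  refine ⟨_, fun ε hε => ((hA ε hε.1).mul_left (L := L) ?_ fun x =>
    abs_unitBump_le_one _).const_mul _⟩
  refine LipschitzWith.of_dist_le_mul fun x y => (hL.dist_le_mul _ _).trans ?_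
  gcongr
  rw [dist_smul₀, Real.norm_of_nonneg hε.1.le]
  exact mul_le_of_le_one_left dist_nonneg hε.2

lemma tendsto_fracLapApprox (hr : r ∈ Ioo (0 : ℝ) (1 / 2)) (hψ : IsTestFun ψ) (x : E d) :
    Tendsto (fun ε => fracLapApprox r ψ ε x) (𝓝[>] 0) (𝓝 (fracLap r ψ x)) := by
  have hp := add_two_mul_mem_Ioo_finrank d hr
  obtain ⟨A, hA, -⟩ := hψ.exists_decayLipschitzWith ((Nat.cast_nonneg _).trans hp.1.le)
  rw [hψ.fracLap_eq hr, ← one_mul (nonlocalOp _ ψ x)]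
  exact ((tendsto_unitBump_smul x).mul (hA.tendsto_nonlocalOp_truncKernel hp x)).const_mul _

lemma abs_fracLap_mul_comp_smul_le (hr : r ∈ Ioo (0 : ℝ) (1 / 2)) (hψ : IsTestFun ψ)
    (hA : DecayLipschitzWith A (d + 2 * r) ψ) {c : ℝ} (hc : 0 < c) (x : E d) :
    |fracLap r (fun y => c ^ (2 * r) * ψ (c • y)) x| ≤
      |fracConst d r| * (decayConst (E d) (d + 2 * r) * A) * c ^ (4 * r) *
        decay (d + 2 * r) (c • x) := by
  have hcc : c ^ (4 * r) = c ^ (2 * r) * c ^ (2 * r) := by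
    rw [← Real.rpow_add hc]; ring_nf
  rw [(hψ.comp_smul hc.ne').fracLap_const_mul hr, hψ.fracLap_comp_smul hr hc, ← mul_assoc, ← hcc,
    abs_mul, abs_of_pos (by positivity)]
  calc c ^ (4 * r) * |fracLap r ψ (c • x)|
      ≤ c ^ (4 * r) * (|fracConst d r| *
          (decayConst (E d) (d + 2 * r) * A * decay (d + 2 * r) (c • x))) := by
        gcongr; exact hA.abs_fracLap_le hr _
    _ = _ := by ring

end IsTestFun

lemma IsDistribFracLap.abs_integral_mul_le_of_tendsto {ι : Type*} {l : Filter ι} [l.NeBot]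
    [l.IsCountablyGenerated] {v g G b : E d → ℝ} {F : ι → E d → ℝ} (h : IsDistribFracLap r v g)
    (hF : ∀ᶠ i in l, IsTestFun (F i)) (hG : MemLp G 2) (hFG : ∀ᶠ i in l, ∀ x, |F i x| ≤ G x)
    (hlim : ∀ x, Tendsto (fun i => F i x) l (𝓝 (f x))) (hb : Integrable b)
    (hFb : ∀ᶠ i in l, ∀ᵐ x, |v x * fracLap r (F i) x| ≤ b x) :
    |∫ x, g x * f x| ≤ ∫ x, b x := by
  have hconv : Tendsto (fun i => ∫ x, g x * F i x) l (𝓝 (∫ x, g x * f x)) := by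
    refine tendsto_integral_filter_of_dominated_convergence (fun x => ‖g x‖ * G x) ?_ ?_
      (h.1.norm.integrable_mul hG) (ae_of_all _ fun x => (hlim x).const_mul _)
    · filter_upwards [hF] with i hi
      exact h.1.aestronglyMeasurable.mul hi.1.continuous.aestronglyMeasurable
    · filter_upwards [hFG] with i hi
      exact ae_of_all _ fun x => by rw [norm_mul]; gcongr; exact hi x
  refine le_of_tendsto hconv.abs ?_
  filter_upwards [hF, hFb] with i hi hib
  rw [← (h.2 _ hi).2, ← Real.norm_eq_abs]
  exact norm_integral_le_of_norm_le hb hib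

-- Up to approximation, `(-Δ)^r v` is tested against `(-Δ)^r ψ(c ·)`, which by duality amounts to
-- testing `v` against `(-Δ)^r (-Δ)^r ψ(c ·)`, which is at most a multiple of
-- `c ^ (4 r) * decay (d + 2 r) (c x)`.
lemma IsTestFun.exists_abs_integral_mul_fracLap_le (hr : r ∈ Ioo (0 : ℝ) (1 / 2))
    (hψ : IsTestFun ψ) :
    ∃ C : ℝ, 0 ≤ C ∧ ∀ (v g w : E d → ℝ) (c : ℝ), IsDistribFracLap r v g → c ∈ Ioc (0 : ℝ) 1 →
      Integrable w → (∀ᵐ x, |v x| * decay (d + 2 * r) (c • x) ≤ w x) →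
      |∫ x, g x * fracLap r (fun y => ψ (c • y)) x| ≤ C * c ^ (4 * r) * ∫ x, w x := by
  have hp := add_two_mul_mem_Ioo_finrank d hr
  have hr0 := hr.1
  obtain ⟨A, hA⟩ := hψ.exists_decayLipschitzWith_fracLapApprox hr
  have hA0 : 0 ≤ A := (hA 1 (right_mem_Ioc.2 one_pos)).const_nonneg
  have hD0 := decayConst_nonneg (E d) (d + 2 * r)
  refine ⟨|fracConst d r| * (decayConst (E d) (d + 2 * r) * A), by positivity,
    fun v g w c hvg hc hw hvw => ?_⟩
  have hc0 : 0 < c := hc.1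
  have hG : MemLp (fun x : E d => c ^ (2 * r) * (A * decay (d + 2 * r) (c • x))) 2 :=
    ((memLp_two_decay_comp_smul (by linarith [hp.1]) hc0.ne').const_mul A).const_mul _
  rw [← integral_const_mul]
  refine hvg.abs_integral_mul_le_of_tendsto (l := 𝓝[>] (0 : ℝ))
    (F := fun ε x => c ^ (2 * r) * fracLapApprox r ψ ε (c • x)) ?_ hG ?_ ?_
    (hw.const_mul _) ?_
  · filter_upwards [self_mem_nhdsWithin] with ε hε
    exact ((isTestFun_fracLapApprox hr hψ hε).comp_smul hc0.ne').const_mul _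
  · filter_upwards [Ioc_mem_nhdsGT one_pos] with ε hε x
    rw [abs_mul, abs_of_pos (by positivity)]
    gcongr
    exact (hA ε hε).bound _
  · intro x
    rw [hψ.fracLap_comp_smul hr hc0]
    exact (hψ.tendsto_fracLapApprox hr _).const_mul _
  · filter_upwards [Ioc_mem_nhdsGT one_pos] with ε hε
    filter_upwards [hvw] with x hx
    rw [abs_mul]
    calc |v x| * |fracLap r (fun y => c ^ (2 * r) * fracLapApprox r ψ ε (c • y)) x|
        ≤ |v x| * (|fracConst d r| * (decayConst (E d) (d + 2 * r) * A) * c ^ (4 * r) *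
            decay (d + 2 * r) (c • x)) := by
          gcongr
          exact (isTestFun_fracLapApprox hr hψ hε.1).abs_fracLap_mul_comp_smul_le hr (hA ε hε) hc0 x
      _ = |fracConst d r| * (decayConst (E d) (d + 2 * r) * A) * c ^ (4 * r) *
            (|v x| * decay (d + 2 * r) (c • x)) := by ring
      _ ≤ _ := by gcongr

end FractionalLaplacian

section DistributionalDerivative

/-- Smooth functions of one real variable with compact support in `U`, which serve as test
functions in time. -/
structure IsTestFunOn (U : Set ℝ) (η : ℝ → ℝ) : Prop where
  contDiff : ContDiff ℝ ∞ η
  hasCompactSupport : HasCompactSupport η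
  tsupport_subset : tsupport η ⊆ U

variable {U : Set ℝ} {η θ : ℝ → ℝ} {G : Type*} [NormedAddCommGroup G] [NormedSpace ℝ G]
  {F : ℝ → G}

namespace IsTestFunOn

lemma integrable (hη : IsTestFunOn U η) : Integrable η :=
  hη.contDiff.continuous.integrable_of_hasCompactSupport hη.hasCompactSupport

lemma eq_zero_of_notMem (hη : IsTestFunOn U η) {t : ℝ} (ht : t ∉ U) : η t = 0 :=
  image_eq_zero_of_notMem_tsupport fun h => ht (hη.tsupport_subset h)

protected lemma deriv (hη : IsTestFunOn U η) : IsTestFunOn U (deriv η) where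
  contDiff := (contDiff_infty_iff_deriv.1 hη.contDiff).2
  hasCompactSupport := hη.hasCompactSupport.deriv
  tsupport_subset := (closure_minimal support_deriv_subset (isClosed_tsupport η)).trans
    hη.tsupport_subset

lemma sub_const_mul (hη : IsTestFunOn U η) (hθ : IsTestFunOn U θ) (a : ℝ) :
    IsTestFunOn U fun t => η t - a * θ t where
  contDiff := hη.contDiff.sub (contDiff_const.mul hθ.contDiff)
  hasCompactSupport := hη.hasCompactSupport.sub hθ.hasCompactSupport.mul_left
  tsupport_subset := (tsupport_sub _ _).trans
    (union_subset hη.tsupport_subset (tsupport_mul_subset_right.trans hθ.tsupport_subset))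

lemma integrable_smul (hη : IsTestFunOn U η) (hF : LocallyIntegrableOn F U) :
    Integrable fun t => η t • F t := by
  have hsupp : Function.support (fun t => η t • F t) ⊆ tsupport η :=
    (Function.support_smul_subset_left _ _).trans (subset_tsupport η)
  rw [← integrableOn_iff_integrable_of_support_subset hsupp]
  exact (hF.integrableOn_compact_subset hη.tsupport_subset hη.hasCompactSupport).continuousOn_smul
    hη.contDiff.continuous.continuousOn hη.hasCompactSupport

end IsTestFunOn

lemma exists_isTestFunOn_integral_eq_one (hU : IsOpen U) (hne : U.Nonempty) :
    ∃ η : ℝ → ℝ, IsTestFunOn U η ∧ ∫ t, η t = 1 := by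
  obtain ⟨t, ht⟩ := hne
  obtain ⟨r, hr, hrU⟩ := Metric.nhds_basis_closedBall.mem_iff.1 (hU.mem_nhds ht)
  let b : ContDiffBump t := ⟨r / 2, r, half_pos hr, half_lt_self hr⟩
  refine ⟨b.normed volume, ⟨b.contDiff_normed, b.hasCompactSupport_normed, ?_⟩, b.integral_normed⟩
  rwa [b.tsupport_normed_eq]

lemma intervalIntegral_eq_zero_of_support_subset_Icc {a a' b t : ℝ}
    (hF : Function.support F ⊆ Icc a b) (hF0 : ∫ x, F x = 0) (ha : a' < a) (ht : t ∉ Icc a b) :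
    ∫ x in a'..t, F x = 0 := by
  rcases lt_or_ge t a with hta | hat
  · refine intervalIntegral.integral_zero_ae (ae_of_all _ fun x hx => ?_)
    by_contra hFx
    exact ((hF hFx).1.trans hx.2).not_gt (max_lt ha hta)
  · rw [intervalIntegral.integral_eq_integral_of_support_subset, hF0]
    have hbt : b < t := not_le.1 fun htb => ht ⟨hat, htb⟩
    exact hF.trans fun x hx => ⟨ha.trans_le hx.1, hx.2.trans hbt.le⟩

lemma IsTestFunOn.exists_deriv_eq (hU : U.OrdConnected) (hθ : IsTestFunOn U θ)
    (h0 : ∫ t, θ t = 0) : ∃ η : ℝ → ℝ, IsTestFunOn U η ∧ deriv η = θ := by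
  rcases (tsupport θ).eq_empty_or_nonempty with he | hne
  · exact ⟨θ, hθ, by simp [tsupport_eq_empty_iff.1 he]⟩
  obtain ⟨a, ha⟩ := hθ.hasCompactSupport.isCompact.exists_isLeast hne
  obtain ⟨b, hb⟩ := hθ.hasCompactSupport.isCompact.exists_isGreatest hne
  have hsub : Function.support θ ⊆ Icc a b := fun t ht =>
    ⟨ha.2 (subset_tsupport θ ht), hb.2 (subset_tsupport θ ht)⟩
  have hder (t : ℝ) : HasDerivAt (fun t => ∫ x in (a - 1)..t, θ x) (θ t) t :=
    (hθ.contDiff.continuous.integral_hasStrictDerivAt _ t).hasDerivAt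
  have hderiv : deriv (fun t => ∫ x in (a - 1)..t, θ x) = θ := funext fun t => (hder t).deriv
  have hts : tsupport (fun t => ∫ x in (a - 1)..t, θ x) ⊆ Icc a b :=
    closure_minimal (fun t ht => by_contra fun hcon => ht
      (intervalIntegral_eq_zero_of_support_subset_Icc hsub h0 (sub_one_lt a) hcon)) isClosed_Icc
  refine ⟨_, ⟨contDiff_infty_iff_deriv.2 ⟨fun t => (hder t).differentiableAt, ?_⟩,
    isCompact_Icc.of_isClosed_subset (isClosed_tsupport _) hts,
    hts.trans (hU.out (hθ.tsupport_subset ha.1) (hθ.tsupport_subset hb.1))⟩, hderiv⟩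
  rw [hderiv]
  exact hθ.contDiff

lemma exists_ae_eq_const_of_integral_deriv_smul_eq_zero [CompleteSpace G] (hUo : IsOpen U)
    (hU : U.OrdConnected) (hF : LocallyIntegrableOn F U)
    (h : ∀ η : ℝ → ℝ, IsTestFunOn U η → ∫ t, deriv η t • F t = 0) :
    ∃ c : G, ∀ᵐ t, t ∈ U → F t = c := by
  rcases U.eq_empty_or_nonempty with rfl | hne
  · exact ⟨0, by simp⟩
  obtain ⟨ζ, hζ, hζ1⟩ := exists_isTestFunOn_integral_eq_one hUo hne
  have hconst (η : ℝ → ℝ) (hη : IsTestFunOn U η) :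
      ∫ t, η t • F t = (∫ t, η t) • ∫ t, ζ t • F t := by
    obtain ⟨ξ, hξ, hξη⟩ := (hη.sub_const_mul hζ (∫ t, η t)).exists_deriv_eq hU (by
      rw [integral_sub hη.integrable (hζ.integrable.const_mul _), integral_const_mul, hζ1, mul_one,
        sub_self])
    have h0 := h ξ hξ
    simp only [hξη, sub_smul, mul_smul] at h0
    rw [integral_sub (hη.integrable_smul hF) ((hζ.integrable_smul hF).fun_smul _),
      integral_smul] at h0
    exact sub_eq_zero.1 h0
  refine ⟨∫ t, ζ t • F t, ?_⟩
  have hae := hUo.ae_eq_zero_of_integral_contDiff_smul_eq_zero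
    (hF.sub ((locallyIntegrable_const (∫ t, ζ t • F t)).locallyIntegrableOn U))
    fun η hη hηc hηU => by
      have hηU : IsTestFunOn U η := ⟨hη, hηc, hηU⟩
      simp only [Pi.sub_apply, smul_sub]
      rw [integral_sub (hηU.integrable_smul hF) (hηU.integrable.smul_const _),
        integral_smul_const, hconst η hηU, sub_self]
  filter_upwards [hae] with t ht htU
  exact sub_eq_zero.1 (ht htU)

lemma IsTestFunOn.exists_forall_le_eq_zero {a : ℝ} (hη : IsTestFunOn (Ioi a) η) :
    ∃ τ : ℝ, a < τ ∧ ∀ t ≤ τ, η t = 0 := by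
  rcases (tsupport η).eq_empty_or_nonempty with he | hne
  · exact ⟨a + 1, by simp, by simp [tsupport_eq_empty_iff.1 he]⟩
  · obtain ⟨b, hb, hbmin⟩ := hη.hasCompactSupport.isCompact.exists_isLeast hne
    obtain ⟨τ, haτ, hτb⟩ := exists_between (mem_Ioi.1 (hη.tsupport_subset hb))
    exact ⟨τ, haτ, fun t ht => image_eq_zero_of_notMem_tsupport fun htη =>
      (hτb.trans_le (hbmin htη)).not_ge ht⟩

lemma neBot_ae_inf_nhdsGT {X : Type*} [LinearOrder X] [TopologicalSpace X] [OrderTopology X]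
    [DenselyOrdered X] [NoMaxOrder X] [MeasurableSpace X] (μ : Measure X) [μ.IsOpenPosMeasure]
    (a : X) : (ae μ ⊓ 𝓝[>] a).NeBot := by
  refine inf_neBot_iff.2 fun {A} hA {B} hB => ?_
  obtain ⟨b, hab, hbB⟩ := mem_nhdsGT_iff_exists_Ioo_subset.1 hB
  obtain ⟨t, htA, htb⟩ :=
    (Measure.dense_of_ae hA).exists_mem_open isOpen_Ioo (nonempty_Ioo.2 hab)
  exact ⟨t, htA, hbB htb⟩

end DistributionalDerivative

section WeakSolution

variable {d : ℕ}

lemma ae_ae_of_ae_restrict_univ_prod {α β : Type*} [MeasureSpace α] [MeasureSpace β]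
    [SFinite (volume : Measure α)] [SFinite (volume : Measure β)] {S : Set β} {P : α → β → Prop}
    (h : ∀ᵐ q ∂(volume.restrict ((univ : Set α) ×ˢ S)), P q.1 q.2) :
    ∀ᵐ t ∂(volume.restrict S), ∀ᵐ x, P x t := by
  rw [Measure.volume_eq_prod, ← Measure.prod_restrict, Measure.restrict_univ] at h
  exact Measure.ae_ae_of_ae_prod (Measure.measurePreserving_swap.quasiMeasurePreserving.ae h)

lemma IsWeight.exists_mul_decay_le [NeZero d] {γ γ₀ : ℝ} (hγ : 0 ≤ γ) (hγ₀ : 0 ≤ γ₀)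
    {ρ : E d → ℝ} (hρ : IsWeight γ γ₀ ρ) : ∃ c : ℝ, 0 < c ∧ ∀ᵐ x, c * decay γ x ≤ ρ x := by
  obtain ⟨c, C, hc, -, hin, hout⟩ := hρ.bounds
  have hne : ∀ᵐ x : E d, x ≠ 0 := compl_mem_ae_iff.2 (measure_singleton 0)
  refine ⟨c, hc, ?_⟩
  filter_upwards [hin, hout, hne] with x hxin hxout hx
  have hx0 : 0 < ‖x‖ := norm_pos_iff.2 hx
  rcases lt_or_ge ‖x‖ 1 with h | h
  · refine le_trans ?_ (hxin h).1
    gcongr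
    exact (decay_le_one hγ x).trans
      (Real.one_le_rpow_of_pos_of_le_one_of_nonpos hx0 h.le (by linarith))
  · refine le_trans ?_ (hxout h).1
    gcongr
    exact Real.rpow_le_rpow_of_nonpos hx0 (by linarith) (by linarith)

lemma abs_rpow_mul_decay_smul_le {γ m p a b c ε N : ℝ} {x : E d} (hγ : γ ∈ Icc 0 p) (hm : 1 ≤ m)
    (hc : 0 < c) (hε : ε ∈ Ioc (0 : ℝ) 1) (ha : a ∈ Icc 0 N) (hb : c * decay γ x ≤ b) :
    |a ^ m| * decay p (ε • x) ≤ N ^ (m - 1) / c * ε ^ (-γ) * (a * b) := by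
  have hε0 := hε.1
  have hpow : |a ^ m| ≤ N ^ (m - 1) * a := by
    rw [abs_of_nonneg (Real.rpow_nonneg ha.1 m), ← sub_add_cancel m 1,
      Real.rpow_add_one' ha.1 (by linarith), add_sub_cancel_right]
    gcongr
    exacts [ha.1, ha.1, ha.2]
  have hdecay : decay γ x ≤ b / c := by rwa [le_div_iff₀' hc]
  calc |a ^ m| * decay p (ε • x) ≤ N ^ (m - 1) * a * (ε ^ (-γ) * (b / c)) := by
        have := (decay_pos p (ε • x)).le
        refine mul_le_mul hpow ((decay_smul_le hγ.1 hγ.2 hε x).trans ?_) this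
          ((abs_nonneg _).trans hpow)
        gcongr
    _ = _ := by ring

lemma IsTestFun.isSpaceTimeTestFun {ψ : E d → ℝ} (hψ : IsTestFun ψ) {η : ℝ → ℝ}
    (hη : IsTestFunOn (Ioi 0) η) : IsSpaceTimeTestFun fun x t => η t * ψ x := by
  have hsub : Function.support (Function.uncurry fun x t => η t * ψ x) ⊆
      tsupport ψ ×ˢ tsupport η := fun q hq =>
    ⟨subset_tsupport _ (right_ne_zero_of_mul hq), subset_tsupport _ (left_ne_zero_of_mul hq)⟩
  refine ⟨(hη.contDiff.comp contDiff_snd).mul (hψ.1.comp contDiff_fst), .of_support_subset_isCompact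
    (hψ.2.isCompact.prod hη.hasCompactSupport.isCompact) hsub, ?_⟩
  exact (closure_minimal hsub ((isClosed_tsupport _).prod (isClosed_tsupport _))).trans
    (prod_mono (subset_univ _) hη.tsupport_subset)

namespace IsWeakSolution

variable {s m γ c : ℝ} {ρ : E d → ℝ} {μ : Measure (E d)} {u : E d → ℝ → ℝ} {η : ℝ → ℝ}

lemma ae_nonneg (hu : IsWeakSolution s m ρ μ u) :
    ∀ᵐ t ∂(volume.restrict (Ioi (0 : ℝ))), ∀ᵐ x, 0 ≤ u x t :=
  ae_ae_of_ae_restrict_univ_prod hu.nonneg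

lemma ae_integral_abs_mul_eq (hu : IsWeakSolution s m ρ μ u) :
    ∀ᵐ t ∂(volume.restrict (Ioi (0 : ℝ))), ∫ x, |u x t| * ρ x = ∫ x, u x t * ρ x := by
  filter_upwards [hu.ae_nonneg] with t ht
  refine integral_congr_ae ?_
  filter_upwards [ht] with x hx
  rw [abs_of_nonneg hx]

lemma exists_ae_mass_le (hu : IsWeakSolution s m ρ μ u) (hρ : ∀ᵐ x, 0 ≤ ρ x) :
    ∃ M : ℝ, ∀ᵐ t ∂(volume.restrict (Ioi (0 : ℝ))),
      Integrable (fun x => u x t * ρ x) ∧ ∫ x, |u x t * ρ x| ≤ M := by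
  obtain ⟨M, hM⟩ := hu.bounded_L1
  refine ⟨M, ?_⟩
  filter_upwards [hM] with t ht
  refine ⟨ht.1, (integral_congr_ae ?_).trans_le ht.2⟩
  filter_upwards [hρ] with x hx
  rw [abs_mul, abs_of_nonneg hx]

lemma aestronglyMeasurable_integral_mul (hu : IsWeakSolution s m ρ μ u) (hρ : AEMeasurable ρ)
    {χ : E d → ℝ} (hχ : Continuous χ) :
    AEStronglyMeasurable (fun t => ∫ x, χ x * (u x t * ρ x)) (volume.restrict (Ioi 0)) := by
  have huρ := hu.measurable
  rw [Measure.volume_eq_prod, ← Measure.prod_restrict, Measure.restrict_univ] at huρ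
  have hmeas : AEStronglyMeasurable (fun q : E d × ℝ => χ q.1 * (u q.1 q.2 * ρ q.1))
      ((volume : Measure (E d)).prod (volume.restrict (Ioi 0))) :=
    (hχ.comp continuous_fst).aestronglyMeasurable.mul
      (huρ.mul (hρ.aestronglyMeasurable.comp_quasiMeasurePreserving
        Measure.quasiMeasurePreserving_fst))
  exact hmeas.prod_swap.integral_prod_right'

lemma exists_weak_eq_mul (hu : IsWeakSolution s m ρ μ u) (hs : s ∈ Ioo (0 : ℝ) 1) :
    ∃ g : E d → ℝ → ℝ,
      (∀ᵐ t ∂(volume.restrict (Ioi (0 : ℝ))),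
        IsDistribFracLap (s / 2) (fun x => u x t ^ m) fun x => g x t) ∧
      ∀ (η : ℝ → ℝ) (ψ : E d → ℝ), IsTestFunOn (Ioi 0) η → IsTestFun ψ →
        ∫ t in Ioi (0 : ℝ), deriv η t * ∫ x, ψ x * (u x t * ρ x) =
          ∫ t in Ioi (0 : ℝ), η t * ∫ x, g x t * fracLap (s / 2) ψ x := by
  have hr : s / 2 ∈ Ioo (0 : ℝ) (1 / 2) := ⟨by linarith [hs.1], by linarith [hs.2]⟩
  obtain ⟨g, -, hg, hweak⟩ := hu.weak_eq
  refine ⟨g, hg, fun η ψ hη hψ => ?_⟩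
  have hmass (t : ℝ) : ∫ x, u x t * deriv (fun τ => η τ * ψ x) t * ρ x =
      deriv η t * ∫ x, ψ x * (u x t * ρ x) := by
    rw [← integral_const_mul]
    refine integral_congr_ae (ae_of_all _ fun x => ?_)
    simp only [deriv_mul_const_field]
    ring
  have hdiffusion (t : ℝ) : ∫ x, g x t * fracLap (s / 2) (fun y => η t * ψ y) x =
      η t * ∫ x, g x t * fracLap (s / 2) ψ x := by
    rw [← integral_const_mul]
    refine integral_congr_ae (ae_of_all _ fun x => ?_)
    simp only [hψ.fracLap_const_mul hr]
    ring
  have h := hweak _ (hψ.isSpaceTimeTestFun hη)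
  simp only [hmass, hdiffusion] at h
  linarith

lemma exists_ae_abs_diffusion_le (hu : IsWeakSolution s m ρ μ u) (hs : s ∈ Ioo (0 : ℝ) 1)
    (hm : 1 ≤ m) (hγ : γ ∈ Icc (0 : ℝ) (d + s)) (hc : 0 < c) (hρ : ∀ᵐ x, c * decay γ x ≤ ρ x)
    {g : E d → ℝ → ℝ} (hg : ∀ᵐ t ∂(volume.restrict (Ioi (0 : ℝ))),
      IsDistribFracLap (s / 2) (fun x => u x t ^ m) fun x => g x t) {τ : ℝ} (hτ : 0 < τ) :
    ∃ K : ℝ, ∀ᵐ t ∂(volume.restrict (Ioi τ)), ∀ ε ∈ Ioc (0 : ℝ) 1,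
      |∫ x, g x t * fracLap (s / 2) (fun y => unitBump d (ε • y)) x| ≤ K * ε ^ (2 * s - γ) := by
  have hr : s / 2 ∈ Ioo (0 : ℝ) (1 / 2) := ⟨by linarith [hs.1], by linarith [hs.2]⟩
  have hρ0 : ∀ᵐ x, 0 ≤ ρ x := by
    filter_upwards [hρ] with x hx using (mul_pos hc (decay_pos γ x)).le.trans hx
  obtain ⟨C, hC0, hC⟩ := (isTestFun_unitBump d).exists_abs_integral_mul_fracLap_le hr
  obtain ⟨M, hM⟩ := hu.exists_ae_mass_le hρ0
  obtain ⟨N, hN⟩ := hu.bounded τ hτ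
  have hτ0 : Ioi τ ⊆ Ioi 0 := Ioi_subset_Ioi hτ.le
  refine ⟨C * (|N ^ (m - 1) / c| * M), ?_⟩
  filter_upwards [ae_ae_of_ae_restrict_univ_prod (P := fun x t => |u x t| ≤ N) hN,
    ae_restrict_of_ae_restrict_of_subset hτ0 hg, ae_restrict_of_ae_restrict_of_subset hτ0 hM,
    ae_restrict_of_ae_restrict_of_subset hτ0 hu.ae_nonneg] with t hut hgt hMt hut0 ε hε
  have hε0 := hε.1
  have hbound : ∀ᵐ x, |u x t ^ m| * decay (d + 2 * (s / 2)) (ε • x) ≤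
      N ^ (m - 1) / c * ε ^ (-γ) * (u x t * ρ x) := by
    filter_upwards [hut, hut0, hρ] with x hxN hx0 hxρ
    exact abs_rpow_mul_decay_smul_le ⟨hγ.1, by linarith [hγ.2]⟩ hm hc hε
      ⟨hx0, (le_abs_self _).trans hxN⟩ hxρ
  have hmass : N ^ (m - 1) / c * ∫ x, u x t * ρ x ≤ |N ^ (m - 1) / c| * M := by
    refine (le_abs_self _).trans ?_
    rw [abs_mul]
    gcongr
    exact abs_integral_le_integral_abs.trans hMt.2
  calc |∫ x, g x t * fracLap (s / 2) (fun y => unitBump d (ε • y)) x|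
      ≤ C * ε ^ (4 * (s / 2)) * ∫ x, N ^ (m - 1) / c * ε ^ (-γ) * (u x t * ρ x) :=
        hC _ _ _ ε hgt hε (hMt.1.const_mul _) hbound
    _ = C * (N ^ (m - 1) / c * ∫ x, u x t * ρ x) * ε ^ (2 * s - γ) := by
        rw [integral_const_mul, show 2 * s - γ = 4 * (s / 2) + -γ by ring, Real.rpow_add hε0]
        ring
    _ ≤ C * (|N ^ (m - 1) / c| * M) * ε ^ (2 * s - γ) := by
        gcongr

lemma tendsto_diffusion (hu : IsWeakSolution s m ρ μ u) (hs : s ∈ Ioo (0 : ℝ) 1) (hm : 1 ≤ m)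
    (hγ : γ ∈ Icc (0 : ℝ) (d + s)) (hγs : γ < 2 * s) (hc : 0 < c)
    (hρ : ∀ᵐ x, c * decay γ x ≤ ρ x) {g : E d → ℝ → ℝ}
    (hg : ∀ᵐ t ∂(volume.restrict (Ioi (0 : ℝ))),
      IsDistribFracLap (s / 2) (fun x => u x t ^ m) fun x => g x t) (hη : IsTestFunOn (Ioi 0) η) :
    Tendsto (fun ε : ℝ => ∫ t in Ioi (0 : ℝ),
      η t * ∫ x, g x t * fracLap (s / 2) (fun y => unitBump d (ε • y)) x) (𝓝[>] 0) (𝓝 0) := by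
  obtain ⟨τ, hτ, hητ⟩ := hη.exists_forall_le_eq_zero
  obtain ⟨K, hK⟩ := hu.exists_ae_abs_diffusion_le hs hm hγ hc hρ hg hτ
  rw [ae_restrict_iff' measurableSet_Ioi] at hK
  have hpow : Tendsto (fun ε : ℝ => ∫ t in Ioi (0 : ℝ), |η t| * (K * ε ^ (2 * s - γ))) (𝓝[>] 0)
      (𝓝 0) := by
    have h := (Real.continuousAt_rpow_const 0 (2 * s - γ) (Or.inr (by linarith))).tendsto
    rw [Real.zero_rpow (by linarith)] at h
    simp only [integral_mul_const]
    simpa using ((h.mono_left nhdsWithin_le_nhds).const_mul K).const_mul (∫ t in Ioi 0, |η t|)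
  refine squeeze_zero_norm' ?_ hpow
  filter_upwards [Ioc_mem_nhdsGT one_pos] with ε hε
  refine norm_integral_le_of_norm_le (hη.integrable.abs.mul_const _).integrableOn ?_
  filter_upwards [ae_restrict_of_ae hK] with t ht
  rw [norm_mul, Real.norm_eq_abs, Real.norm_eq_abs]
  rcases le_or_gt t τ with htτ | htτ
  · simp [hητ t htτ]
  · gcongr
    exact ht htτ ε hε

lemma tendsto_mass (hu : IsWeakSolution s m ρ μ u) (hρm : AEMeasurable ρ) (hρ : ∀ᵐ x, 0 ≤ ρ x)
    (hη : IsTestFunOn (Ioi 0) η) :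
    Tendsto (fun ε : ℝ => ∫ t in Ioi (0 : ℝ),
        η t * ∫ x, unitBump d (ε • x) * (u x t * ρ x)) (𝓝[>] 0)
      (𝓝 (∫ t in Ioi (0 : ℝ), η t * ∫ x, u x t * ρ x)) := by
  obtain ⟨M, hM⟩ := hu.exists_ae_mass_le hρ
  have hcont (ε : ℝ) : Continuous fun x : E d => unitBump d (ε • x) :=
    (unitBump d).continuous.comp (continuous_const_smul ε)
  have hcut (ε : ℝ) (x : E d) (a : ℝ) : ‖unitBump d (ε • x) * a‖ ≤ |a| := by
    rw [norm_mul]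
    exact mul_le_of_le_one_left (norm_nonneg _) (abs_unitBump_le_one _)
  refine tendsto_integral_filter_of_dominated_convergence (fun t => ‖η t‖ * M)
    (.of_forall fun ε => hη.contDiff.continuous.aestronglyMeasurable.mul
      (hu.aestronglyMeasurable_integral_mul hρm (hcont ε)))
    (.of_forall fun ε => ?_) (hη.integrable.norm.mul_const M).integrableOn ?_
  · filter_upwards [hM] with t ht
    rw [norm_mul]
    gcongr
    exact (norm_integral_le_of_norm_le ht.1.abs (ae_of_all _ fun x => hcut ε x _)).trans ht.2
  · filter_upwards [hM] with t ht
    refine (tendsto_integral_filter_of_dominated_convergence (fun x => |u x t * ρ x|)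
      (.of_forall fun ε => (hcont ε).aestronglyMeasurable.mul ht.1.aestronglyMeasurable)
      (.of_forall fun ε => ae_of_all _ fun x => hcut ε x _) ht.1.abs
      (ae_of_all _ fun x => ?_)).const_mul _
    simpa only [Pi.mul_apply, one_mul] using (tendsto_unitBump_smul x).mul_const (u x t * ρ x)

lemma integral_deriv_mul_mass_eq_zero (hu : IsWeakSolution s m ρ μ u) (hs : s ∈ Ioo (0 : ℝ) 1)
    (hm : 1 ≤ m) (hγ : γ ∈ Icc (0 : ℝ) (d + s)) (hγs : γ < 2 * s) (hρm : AEMeasurable ρ)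
    (hc : 0 < c) (hρ : ∀ᵐ x, c * decay γ x ≤ ρ x) (hη : IsTestFunOn (Ioi 0) η) :
    ∫ t, deriv η t * ∫ x, u x t * ρ x = 0 := by
  have hρ0 : ∀ᵐ x, 0 ≤ ρ x := by
    filter_upwards [hρ] with x hx using (mul_pos hc (decay_pos γ x)).le.trans hx
  obtain ⟨g, hg, hweak⟩ := hu.exists_weak_eq_mul hs
  rw [← setIntegral_eq_integral_of_forall_compl_eq_zero (s := Ioi 0) fun t ht => by
    rw [hη.deriv.eq_zero_of_notMem ht, zero_mul]]
  refine tendsto_nhds_unique (hu.tendsto_mass hρm hρ0 hη.deriv)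
    ((hu.tendsto_diffusion hs hm hγ hγs hc hρ hg hη).congr' ?_)
  filter_upwards [self_mem_nhdsWithin] with ε hε
  exact (hweak η _ hη ((isTestFun_unitBump d).comp_smul (ne_of_gt hε))).symm

lemma locallyIntegrableOn_mass (hu : IsWeakSolution s m ρ μ u) (hρm : AEMeasurable ρ)
    (hρ : ∀ᵐ x, 0 ≤ ρ x) : LocallyIntegrableOn (fun t => ∫ x, u x t * ρ x) (Ioi 0) := by
  obtain ⟨M, hM⟩ := hu.exists_ae_mass_le hρ
  have hmeas : AEStronglyMeasurable (fun t => ∫ x, u x t * ρ x) (volume.restrict (Ioi 0)) := by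
    simpa only [one_mul] using hu.aestronglyMeasurable_integral_mul hρm (χ := fun _ => 1)
      continuous_const
  refine locallyIntegrableOn_of_locallyIntegrable_restrict
    ((memLp_top_of_bound hmeas M ?_).locallyIntegrable le_top)
  filter_upwards [hM] with t ht
  exact (norm_integral_le_integral_norm _).trans ht.2

lemma eq_measureReal_univ_of_ae_mass_eq (hu : IsWeakSolution s m ρ μ u) {a : ℝ}
    (ha : ∀ᵐ t, t ∈ Ioi (0 : ℝ) → ∫ x, u x t * ρ x = a) : a = μ.real univ := by
  have := neBot_ae_inf_nhdsGT (volume : Measure ℝ) 0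
  have hlim := hu.initial (BoundedContinuousFunction.const _ 1)
  simp only [BoundedContinuousFunction.const_apply, one_mul, integral_const, smul_eq_mul,
    mul_one] at hlim
  refine tendsto_nhds_unique (tendsto_const_nhds.congr' ?_) hlim
  filter_upwards [mem_inf_of_left ha, mem_inf_of_right self_mem_nhdsWithin] with t hta ht
  exact (hta ht).symm

end IsWeakSolution

end WeakSolution

end

end FracPME

theorem proposition4p1_general (d : ℕ) (s m γ c : ℝ) (hs : 0 < s) (hs' : s < 1) (hm : 1 ≤ m)
    (hγ : 0 ≤ γ) (hγs : γ < 2 * s) (hγd : γ ≤ d + s)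
    (ρ : FracPME.E d → ℝ) (hρm : AEMeasurable ρ) (hc : 0 < c)
    (hρ : ∀ᵐ x, c * FracPME.decay γ x ≤ ρ x)
    (μ : Measure (FracPME.E d)) [IsFiniteMeasure μ]
    (u : FracPME.E d → ℝ → ℝ) (hu : FracPME.IsWeakSolution s m ρ μ u) :
    ∀ᵐ t ∂(volume.restrict (Ioi (0 : ℝ))),
      Integrable (fun x => u x t * ρ x) ∧
        ∫ x, |u x t| * ρ x = ∫ x, u x t * ρ x ∧
        ∫ x, u x t * ρ x = μ.real univ := by
  have hρ0 : ∀ᵐ x, 0 ≤ ρ x := by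
    filter_upwards [hρ] with x hx using (mul_pos hc (FracPME.decay_pos γ x)).le.trans hx
  obtain ⟨M, hM⟩ := hu.exists_ae_mass_le hρ0
  obtain ⟨a, ha⟩ := FracPME.exists_ae_eq_const_of_integral_deriv_smul_eq_zero isOpen_Ioi
    ordConnected_Ioi (hu.locallyIntegrableOn_mass hρm hρ0) fun η hη =>
      hu.integral_deriv_mul_mass_eq_zero ⟨hs, hs'⟩ hm ⟨hγ, hγd⟩ hγs hρm hc hρ hη
  filter_upwards [hM, hu.ae_integral_abs_mul_eq, (ae_restrict_iff' measurableSet_Ioi).2 ha]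
    with t ht habs hta
  exact ⟨ht.1, habs, hta.trans (hu.eq_measureReal_univ_of_ae_mass_eq ha)⟩

theorem proposition4p1 (d : ℕ) (s m γ γ₀ : ℝ) (hs : 0 < s) (hs' : s < 1)
    (hd : 2 * s < (d : ℝ)) (hm : 1 < m)
    (hγ : 0 ≤ γ) (hγs : γ < 2 * s) (hγd : γ ≤ (d : ℝ) - 2 * s)
    (hγ₀ : 0 ≤ γ₀) (hγ₀γ : γ₀ ≤ γ)
    (ρ : FracPME.E d → ℝ) (hρ : FracPME.IsWeight γ γ₀ ρ)
    (μ : MeasureTheory.Measure (FracPME.E d)) [MeasureTheory.IsFiniteMeasure μ]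
    (u : FracPME.E d → ℝ → ℝ) (hu : FracPME.IsWeakSolution s m ρ μ u) :
    ∀ᵐ t ∂(MeasureTheory.volume.restrict (Set.Ioi (0 : ℝ))),
      MeasureTheory.Integrable (fun x => u x t * ρ x) MeasureTheory.volume ∧
        ∫ x, |u x t| * ρ x = ∫ x, u x t * ρ x ∧
        ∫ x, u x t * ρ x = μ.real Set.univ := by
  have : NeZero d := ⟨by rintro rfl; rw [Nat.cast_zero] at hd; linarith⟩
  obtain ⟨c, hc, hcρ⟩ := hρ.exists_mul_decay_le hγ hγ₀
  exact proposition4p1_general d s m γ c hs hs' hm.le hγ hγs (by linarith) ρ hρ.aemeasurable hc hcρ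
    μ u hu
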